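/- Let $m\ge 2$ be an even integer and let $\sigma>0$. Let $\mathsf X=[-1,1]$ and $\mathcal F=\{f_\theta(x)=(x-\theta)^m:\theta\in[-1,1]\}$, and consider the oracle that answers a query $x\in\mathsf X$ about $f\in\mathcal F$ with $Y=(f(x)+W,\,f'(x)+Z)$, where $W,Z\sim\mathcal N(0,\sigma^2)$ are mutually independent and independent of the past. A weak infinite-step algorithm is a sequence of measurable maps $\mathcal A_t:\mathsf X^{t-1}\times(\mathbb R^2)^{t-1}\to\mathsf X$, $t=1,2,\dots$; its $t$-th query is $X_t=\mathcal A_t(X^{t-1},Y^{t-1})$, where $X^{t-1},Y^{t-1}$ are the first $t-1$ queries and answers, and its candidate minimizer after $t$ oracle calls is $X_{t+1}$, with error $\operatorname{err}_{\mathcal A}(t,f)=f(X_{t+1})-\inf_{\mathsf X}f$. Let the $2$-anytime exponent be $$\gamma^{(2)}=\sup\Bigl\{\gamma\ge 0:\ \text{there is a weak infinite-step algorithm }\mathcal A\text{ with }\limsup_{t\to\infty}\,t^{\gamma}\,\sup_{f\in\mathcal F}\mathbb E\bigl[\operatorname{err}_{\mathcal A}(t,f)^2\bigr]<\infty\Bigr\}.$$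 Then $\gamma^{(2)}\le\frac{m}{m-1}$. -/

import Mathlib

open MeasureTheory ProbabilityTheory Filter
open scoped NNReal ENNReal

namespace StochOpt

/-- `C(X, ℝ)` carries the Borel `σ`-algebra of its usual topology (for compact `X`, the topology of
the sup norm). -/
instance instMeasurableSpaceContinuousMap {X : Type*} [TopologicalSpace X] :
    MeasurableSpace C(X, ℝ) := borel _

instance instBorelSpaceContinuousMap {X : Type*} [TopologicalSpace X] : BorelSpace C(X, ℝ) := ⟨rfl⟩

/-- A problem class: a compact convex domain, a set of convex (continuous) functions on it, and an
oracle, that is, a Markov kernel `P(dy | f, x)` from instances and query points to answers. -/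
structure ProblemClass (E : Type*) [NormedAddCommGroup E] [NormedSpace ℝ E] [FiniteDimensional ℝ E]
    [MeasurableSpace E] [BorelSpace E] (Y : Type*) [MeasurableSpace Y] where
  /-- the problem domain -/
  domain : Set E
  isCompact_domain : IsCompact domain
  convex_domain : Convex ℝ domain
  /-- the instance space -/
  instances : Set C(domain, ℝ)
  convexOn_instances : ∀ f ∈ instances, ∃ g : E → ℝ, ConvexOn ℝ domain g ∧ ∀ x : domain, g x = f x
  /-- the oracle -/
  oracle : Kernel (instances × domain) Y
  isMarkovKernel_oracle : IsMarkovKernel oracle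

namespace ProblemClass

variable {E : Type*} [NormedAddCommGroup E] [NormedSpace ℝ E] [FiniteDimensional ℝ E]
  [MeasurableSpace E] [BorelSpace E] {Y : Type*} [MeasurableSpace Y]

/-- The data after `t` oracle calls: the first `t` pairs of a query and its answer. -/
abbrev History (P : ProblemClass E Y) (t : ℕ) : Type _ := Fin t → P.domain × Y

/-- A (deterministic) weak infinite-step algorithm: `A.next t` maps the data of the first `t` oracle
calls to the point `X_{t+1}`, which is at once the candidate minimizer after `t` oracle calls and
the next query. -/
structure Algorithm (P : ProblemClass E Y) where
  next : (t : ℕ) → P.History t → P.domain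
  measurable_next : ∀ t, Measurable (next t)

variable {P : ProblemClass E Y}

/-- The conditional law of the next answer of the oracle given the data of `t` oracle calls, when
the instance is `f`. -/
noncomputable def Algorithm.answer (A : P.Algorithm) (f : P.instances) (t : ℕ) :
    Kernel (P.History t) Y :=
  P.oracle.comap (fun h => (f, A.next t h)) (measurable_const.prodMk (A.measurable_next t))

instance (A : P.Algorithm) (f : P.instances) (t : ℕ) : IsMarkovKernel (A.answer f t) :=
  haveI := P.isMarkovKernel_oracle
  inferInstanceAs (IsMarkovKernel (P.oracle.comap _ _))

/-- Append to the data of `t` oracle calls the next query and the answer to it. -/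
def Algorithm.extend (A : P.Algorithm) (t : ℕ) (p : P.History t × Y) : P.History (t + 1) :=
  Fin.snoc (α := fun _ => P.domain × Y) p.1 (A.next t p.1, p.2)

lemma Algorithm.measurable_extend (A : P.Algorithm) (t : ℕ) : Measurable (A.extend t) := by
  refine measurable_pi_iff.2 fun i => ?_
  refine Fin.lastCases ?_ (fun j => ?_) i
  · simp only [Algorithm.extend, Fin.snoc_last]
    exact ((A.measurable_next t).comp measurable_fst).prodMk measurable_snd
  · simp only [Algorithm.extend, Fin.snoc_castSucc]
    exact (measurable_pi_apply j).comp measurable_fst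

/-- The law of the data of the first `t` oracle calls in the interaction of the algorithm with the
oracle, when the instance is `f`. -/
noncomputable def Algorithm.law (A : P.Algorithm) (f : P.instances) :
    (t : ℕ) → Measure (P.History t)
  | 0 => Measure.dirac Fin.elim0
  | t + 1 => (A.law f t ⊗ₘ A.answer f t).map (A.extend t)

instance Algorithm.isProbabilityMeasure_law (A : P.Algorithm) (f : P.instances) (t : ℕ) :
    IsProbabilityMeasure (A.law f t) := by
  induction t with
  | zero => rw [Algorithm.law]; infer_instance
  | succ t ih =>
    rw [Algorithm.law]
    exact Measure.isProbabilityMeasure_map (A.measurable_extend t).aemeasurable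

/-- `f(x) - inf f`, the error of the candidate minimizer `x` for the instance `f`. -/
noncomputable def err (P : ProblemClass E Y) (f : P.instances) (x : P.domain) : ℝ :=
  f.1 x - ⨅ z, f.1 z

/-- `𝔼 err^r(t, f)`: the expected `r`-th power of the error after `t` oracle calls. -/
noncomputable def Algorithm.expectedErr (A : P.Algorithm) (r : ℝ) (t : ℕ) (f : P.instances) :
    ℝ≥0∞ :=
  ∫⁻ h, ENNReal.ofReal (P.err f (A.next t h) ^ r) ∂(A.law f t)

/-- The worst-case expected `r`-th power of the error after `t` oracle calls. -/
noncomputable def Algorithm.worstErr (A : P.Algorithm) (r : ℝ) (t : ℕ) : ℝ≥0∞ :=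
  ⨆ f : P.instances, A.expectedErr r t f

/-- The `r`-anytime exponent: the supremum of all `γ ≥ 0` such that some weak infinite-step
algorithm satisfies `limsup t ^ γ * worstErr r t < ∞` as `t → ∞`. -/
noncomputable def anytimeExponent (P : ProblemClass E Y) (r : ℝ) : ℝ≥0∞ :=
  ⨆ (γ : ℝ≥0) (_ : ∃ A : P.Algorithm,
    limsup (fun t : ℕ => (t : ℝ≥0∞) ^ (γ : ℝ) * A.worstErr r t) atTop < ∞), (γ : ℝ≥0∞)

end ProblemClass

/-- The interval `[-1, 1]`. -/
abbrev Interval : Set ℝ := Set.Icc (-1) 1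

/-- The exact first-order information `(f(x), f'(x))` for a function on `[-1, 1]` (one-sided
derivatives at the end points). -/
noncomputable def firstOrder (f : C(Interval, ℝ)) (x : Interval) : ℝ × ℝ :=
  (f x, derivWithin (Set.IccExtend (neg_le_self zero_le_one) f) Interval x)

/-- The law of `(W, Z)` with `W`, `Z` independent Gaussian variables of mean `0` and variance
`σ ^ 2`. -/
noncomputable def noise (σ : ℝ≥0) : Measure (ℝ × ℝ) :=
  (gaussianReal 0 (σ ^ 2)).prod (gaussianReal 0 (σ ^ 2))

instance (σ : ℝ≥0) : IsProbabilityMeasure (noise σ) :=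
  inferInstanceAs (IsProbabilityMeasure (Measure.prod _ _))

/-- The function `x ↦ (x - θ) ^ m` on `[-1, 1]`. -/
def powFun (m : ℕ) (θ : Interval) : C(Interval, ℝ) where
  toFun x := ((x : ℝ) - θ) ^ m
  continuous_toFun := by fun_prop

lemma firstOrder_powFun (m : ℕ) (θ x : Interval) :
    firstOrder (powFun m θ) x = (((x : ℝ) - θ) ^ m, m * ((x : ℝ) - θ) ^ (m - 1)) := by
  refine Prod.ext rfl ?_
  have h : Set.EqOn (Set.IccExtend (neg_le_self zero_le_one) (powFun m θ))
      (fun y : ℝ => (y - θ) ^ m) Interval := fun y hy => by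
    rw [Set.IccExtend_of_mem _ _ hy]; rfl
  change derivWithin _ Interval (x : ℝ) = _
  rw [derivWithin_congr h (h x.2)]
  have hd : HasDerivAt (fun y : ℝ => (y - θ) ^ m) (m * ((x : ℝ) - θ) ^ (m - 1)) x := by
    simpa using ((hasDerivAt_id (x : ℝ)).sub_const (θ : ℝ)).fun_pow m
  exact hd.hasDerivWithinAt.derivWithin
    (uniqueDiffOn_Icc (by norm_num : (-1 : ℝ) < 1) _ x.2)

lemma continuous_powFun (m : ℕ) : Continuous (powFun m) :=
  ContinuousMap.continuous_of_continuous_uncurry _ (by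
    change Continuous fun p : Interval × Interval => ((p.2 : ℝ) - p.1) ^ m
    fun_prop)

lemma injective_powFun {m : ℕ} (hm : 0 < m) : Function.Injective (powFun m) := fun θ θ' h => by
  have h1 : ((θ : ℝ) - θ) ^ m = ((θ : ℝ) - θ') ^ m := congrArg (fun f => f θ) h
  rw [sub_self, zero_pow hm.ne'] at h1
  exact Subtype.ext (sub_eq_zero.1 (pow_eq_zero_iff hm.ne' |>.1 h1.symm))

lemma measurable_firstOrder {m : ℕ} (hm : 0 < m) :
    Measurable fun p : Set.range (powFun m) × Interval => firstOrder p.1 p.2 := by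
  let e := ((continuous_powFun m).isClosedEmbedding (injective_powFun hm)).isEmbedding.toHomeomorph
  have he : ∀ f : Set.range (powFun m), powFun m (e.symm f) = f := fun f =>
    congrArg Subtype.val (e.apply_symm_apply f)
  have h : (fun p : Set.range (powFun m) × Interval => firstOrder p.1 p.2) =
      fun p => (((p.2 : ℝ) - e.symm p.1) ^ m, m * ((p.2 : ℝ) - e.symm p.1) ^ (m - 1)) := by
    funext p
    rw [← firstOrder_powFun, he]
  have hs : Measurable fun p : Set.range (powFun m) × Interval => e.symm p.1 :=
    e.symm.continuous.measurable.comp measurable_fst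
  rw [h]
  fun_prop

lemma convexOn_powFun {m : ℕ} (hm : Even m) (θ : Interval) :
    ConvexOn ℝ Interval fun x : ℝ => (x - θ) ^ m := by
  have h := (hm.convexOn_pow (𝕜 := ℝ)).translate_left (-(θ : ℝ))
  refine ConvexOn.subset ?_ (Set.subset_univ _) (convex_Icc _ _)
  simpa [Function.comp_def, sub_eq_add_neg, add_comm] using h

/-- The oracle that answers a query `x` about an instance `f` of the form `x ↦ (x - θ) ^ m` with
`Y = (f(x) + W, f'(x) + Z)`. -/
noncomputable def powOracle {m : ℕ} (hm : 0 < m) (σ : ℝ≥0) :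
    Kernel (Set.range (powFun m) × Interval) (ℝ × ℝ) where
  toFun p := (noise σ).map fun w => firstOrder p.1 p.2 + w
  measurable' := by
    have hf := measurable_firstOrder hm
    refine Measure.measurable_of_measurable_coe _ fun s hs => ?_
    have hg : Measurable fun q : (Set.range (powFun m) × Interval) × (ℝ × ℝ) =>
        firstOrder q.1.1 q.1.2 + q.2 := (hf.comp measurable_fst).add measurable_snd
    convert measurable_measure_prodMk_left (ν := noise σ) (hg hs) using 2 with p
    exact Measure.map_apply (measurable_const_add _) hs

/-- The problem class of the functions `x ↦ (x - θ) ^ m`, `θ ∈ [-1, 1]`, on `[-1, 1]` with the noisy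
first-order oracle of noise variance `σ ^ 2`. -/
noncomputable def powClass {m : ℕ} (hm : 0 < m) (hm' : Even m) (σ : ℝ≥0) :
    ProblemClass ℝ (ℝ × ℝ) where
  domain := Interval
  isCompact_domain := isCompact_Icc
  convex_domain := convex_Icc _ _
  instances := Set.range (powFun m)
  convexOn_instances := by
    rintro _ ⟨θ, rfl⟩
    exact ⟨_, convexOn_powFun hm' θ, fun _ => rfl⟩
  oracle := powOracle hm σ
  isMarkovKernel_oracle := ⟨fun _ =>
    Measure.isProbabilityMeasure_map (measurable_const_add _).aemeasurable⟩

end StochOpt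

namespace StochOpt

/-! ### Likelihood ratios of interaction histories. -/

section Likelihood

variable {E : Type*} [NormedAddCommGroup E] [NormedSpace ℝ E] [FiniteDimensional ℝ E]
  [MeasurableSpace E] [BorelSpace E] {Y : Type*} [MeasurableSpace Y] {P : ProblemClass E Y}

/-! Each query is also a candidate minimizer, so an algorithm that is good at all times must query
near the minimizer, where `(x - θ) ^ m` is flat and the answers carry little information about `θ`.

Write `m = n + 2` and suppose some `γ > m / (m - 1)` is achieved. Compare `θ = 0` with `θ = δ`. A
query at `x` separates the two by a Gaussian divergence of order `δ² (x^(2(m-2)) + δ^(2(m-2)))`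
(`sq_add_sq_firstOrder_le`). Under `θ = 0` the moment `𝔼 x^(2m)` at time `s` is `O(s^(-m/(m-1)))`,
hence `𝔼 x^(2(m-2))` is `O(s^(-(m-2)/(m-1)))`. Summing over `s < t`, by the chain rule for
divergences (`exists_logLikelihood`), gives total information `O(δ² t^(1/(m-1)) + t δ^(2(m-1)))`
(`sum_divergence_le`).

Take `δ` of order `t^(-γ/(2m))`, the accuracy claimed at time `t`. Both terms then tend to `0`
because `γ > m / (m - 1)`. Yet thresholding the candidate at `δ / 2` would test the two hypotheses
with small error, against `le_testing_error`; this is `not_forall_integral_le`. -/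

lemma ProblemClass.Algorithm.lintegral_law_succ (A : P.Algorithm) (f : P.instances) (t : ℕ)
    {u : P.History (t + 1) → ℝ≥0∞} (hu : Measurable u) :
    ∫⁻ h, u h ∂(A.law f (t + 1)) =
      ∫⁻ h, ∫⁻ y, u (A.extend t (h, y)) ∂(P.oracle (f, A.next t h)) ∂(A.law f t) := by
  rw [ProblemClass.Algorithm.law, lintegral_map hu (A.measurable_extend t),
    Measure.lintegral_compProd (f := fun p => u (A.extend t p)) (hu.comp (A.measurable_extend t))]
  rfl

/-- If the laws of the answers have log-likelihood ratios `r x` with integral `-k x`, then the laws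
of the histories have a log-likelihood ratio whose integral is minus the accumulated `k`. -/
lemma ProblemClass.Algorithm.exists_logLikelihood (A : P.Algorithm) (f g : P.instances)
    {r : P.domain → Y → ℝ} (hr : Measurable (Function.uncurry r)) {k : P.domain → ℝ} {M : ℝ}
    (hdens : ∀ x, ∀ u : Y → ℝ≥0∞, Measurable u → ∫⁻ y, u y ∂(P.oracle (g, x)) =
      ∫⁻ y, u y * ENNReal.ofReal (Real.exp (r x y)) ∂(P.oracle (f, x)))
    (hint : ∀ x, Integrable (r x) (P.oracle (f, x)))
    (hk : ∀ x, ∫ y, r x y ∂(P.oracle (f, x)) = -k x)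
    (hM : ∀ x, ∫ y, ‖r x y‖ ∂(P.oracle (f, x)) ≤ M) (t : ℕ) :
    ∃ l : P.History t → ℝ, Measurable l ∧ Integrable l (A.law f t) ∧
      (∀ u : P.History t → ℝ≥0∞, Measurable u → ∫⁻ h, u h ∂(A.law g t) =
        ∫⁻ h, u h * ENNReal.ofReal (Real.exp (l h)) ∂(A.law f t)) ∧
      ∫ h, l h ∂(A.law f t) = -∑ s ∈ Finset.range t, ∫ h, k (A.next s h) ∂(A.law f s) := by
  have := P.isMarkovKernel_oracle
  induction t with
  | zero => exact ⟨fun _ => 0, measurable_const, integrable_zero _ _ _, by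
      intro u _; simp [ProblemClass.Algorithm.law], by simp⟩
  | succ t ih =>
    obtain ⟨l, hlm, hli, hld, hlk⟩ := ih
    have hinit : Measurable fun h : P.History (t + 1) => (Fin.init h : P.History t) :=
      measurable_pi_iff.2 fun i => measurable_pi_apply i.castSucc
    have hlast : Measurable fun h : P.History (t + 1) => h (Fin.last t) := measurable_pi_apply _
    -- Only the last answer contributes: the query is the same function of the past under both
    -- instances, so it cancels in the ratio.
    let l' : P.History (t + 1) → ℝ :=
      fun h => l (Fin.init h) + r (h (Fin.last t)).1 (h (Fin.last t)).2
    have hl'm : Measurable l' := (hlm.comp hinit).add (hr.comp hlast)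
    have hl'e : ∀ h y, l' (A.extend t (h, y)) = l h + r (A.next t h) y := fun h y => by
      simp [l', ProblemClass.Algorithm.extend]
    have hrm : Measurable fun p : P.History t × Y => r (A.next t p.1) p.2 :=
      hr.comp (((A.measurable_next t).comp measurable_fst).prodMk measurable_snd)
    have hri : Integrable (fun p : P.History t × Y => r (A.next t p.1) p.2)
        (A.law f t ⊗ₘ A.answer f t) := by
      refine (Measure.integrable_compProd_iff hrm.aestronglyMeasurable).2
        ⟨ae_of_all _ fun h => hint (A.next t h), ?_⟩
      -- Integrability at each query does not suffice here; the bound `M`, uniform in the query,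
      -- controls the outer integral.
      refine Integrable.of_bound
        (StronglyMeasurable.integral_kernel_prod_right' (κ := A.answer f t)
          hrm.norm.stronglyMeasurable).aestronglyMeasurable M (ae_of_all _ fun h => ?_)
      rw [Real.norm_of_nonneg (integral_nonneg fun _ => norm_nonneg _)]
      exact hM (A.next t h)
    have hli' : Integrable (fun p : P.History t × Y => l p.1) (A.law f t ⊗ₘ A.answer f t) := by
      have : Integrable l ((A.law f t ⊗ₘ A.answer f t).map Prod.fst) := by
        rw [← Measure.fst, Measure.fst_compProd]; exact hli
      exact this.comp_measurable measurable_fst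
    have hcomp : (fun p => l' (A.extend t p)) =
        fun p : P.History t × Y => l p.1 + r (A.next t p.1) p.2 := funext fun p => hl'e p.1 p.2
    refine ⟨l', hl'm, ?_, fun u hu => ?_, ?_⟩
    · rw [ProblemClass.Algorithm.law, integrable_map_measure hl'm.aestronglyMeasurable
        (A.measurable_extend t).aemeasurable]
      exact (hli'.add hri).congr (ae_of_all _ fun p => (hl'e p.1 p.2).symm)
    · have hue := hu.comp (A.measurable_extend t)
      rw [A.lintegral_law_succ g t hu, A.lintegral_law_succ f t (by fun_prop), hld]
      · refine lintegral_congr fun h => ?_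
        have huh : Measurable fun y => u (A.extend t (h, y)) := hue.comp measurable_prodMk_left
        have hrh : Measurable fun y => r (A.next t h) y := hrm.comp measurable_prodMk_left
        have hur : Measurable fun y =>
            u (A.extend t (h, y)) * ENNReal.ofReal (Real.exp (r (A.next t h) y)) :=
          huh.mul (by fun_prop)
        rw [hdens _ _ huh, ← lintegral_mul_const _ hur]
        refine lintegral_congr fun y => ?_
        rw [hl'e, Real.exp_add, ENNReal.ofReal_mul (Real.exp_nonneg _)]
        ring
      · exact Measurable.lintegral_kernel_prod_right' (κ := A.answer g t) hue
    · rw [ProblemClass.Algorithm.law, integral_map (A.measurable_extend t).aemeasurable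
        hl'm.aestronglyMeasurable, hcomp, integral_add hli' hri,
        Measure.integral_compProd hli', Measure.integral_compProd hri, Finset.sum_range_succ]
      simp only [integral_const, probReal_univ, one_smul, hlk]
      have : ∀ h, ∫ y, r (A.next t h) y ∂(A.answer f t h) = -k (A.next t h) :=
        fun h => hk (A.next t h)
      simp only [this, integral_neg]
      ring

end Likelihood

/-! ### Testing two hypotheses. -/

/-- Two probability measures with log-likelihood ratio `l` cannot be told apart reliably. -/
lemma le_testing_error {Ω : Type*} [MeasurableSpace Ω] {μ ν : Measure Ω} [IsProbabilityMeasure μ]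
    [IsProbabilityMeasure ν] {l : Ω → ℝ} (hlm : Measurable l) (hli : Integrable l μ)
    (hd : ∀ u : Ω → ℝ≥0∞, Measurable u →
      ∫⁻ x, u x ∂ν = ∫⁻ x, u x * ENNReal.ofReal (Real.exp (l x)) ∂μ)
    {s : Set Ω} (hs : MeasurableSet s) :
    3 / 4 + (∫ x, l x ∂μ) / 2 ≤ 2 * (ν.real s + μ.real sᶜ) := by
  have hset : ∀ a, MeasurableSet a → ν a = ∫⁻ x in a, ENNReal.ofReal (Real.exp (l x)) ∂μ := by
    intro a ha
    rw [← lintegral_indicator_one ha, hd _ (measurable_one.indicator ha), ← lintegral_indicator ha]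
    refine lintegral_congr fun x => ?_
    by_cases hx : x ∈ a <;> simp [hx]
  have hei : Integrable (fun x => Real.exp (l x)) μ := by
    refine ⟨by fun_prop, ?_⟩
    rw [hasFiniteIntegral_iff_ofReal (ae_of_all _ fun x => Real.exp_nonneg _),
      ← setLIntegral_univ, ← hset _ MeasurableSet.univ]
    exact measure_lt_top _ _
  have hreal : ∀ a, MeasurableSet a → ∫ x in a, Real.exp (l x) ∂μ = ν.real a := by
    intro a ha
    rw [integral_eq_lintegral_of_nonneg_ae (ae_of_all _ fun x => Real.exp_nonneg _) (by fun_prop),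
      ← hset a ha, Measure.real]
  have htot : ∫ x, Real.exp (l x) ∂μ = 1 := by
    rw [← setIntegral_univ, hreal _ MeasurableSet.univ, probReal_univ]
  -- With densities `1` and `exp l`, the geometric mean `exp (l / 2)` is at most `2 * min + max / 8`
  -- by AM-GM. Here `max` is at most the sum of the densities, which costs `1 / 4` after
  -- integration, and `min` is at most the density selected by `s`.
  have key : ∀ x, 1 + l x / 2 ≤ 1 / 8 + Real.exp (l x) / 8 +
      2 * (s.indicator (fun x => Real.exp (l x)) x + sᶜ.indicator (fun _ => (1 : ℝ)) x) := by
    intro x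
    have h1 : l x / 2 + 1 ≤ Real.exp (l x / 2) := Real.add_one_le_exp _
    have h2 : Real.exp (l x) = Real.exp (l x / 2) ^ 2 := by
      rw [← Real.exp_nat_mul]; congr 1; push_cast; ring
    by_cases hx : x ∈ s
    · simp only [hx, Set.indicator_of_mem, Set.mem_compl_iff, not_true_eq_false, not_false_eq_true,
        Set.indicator_of_notMem, h2]
      nlinarith [sq_nonneg (4 * Real.exp (l x / 2) - 1), sq_nonneg (Real.exp (l x / 2))]
    · simp only [hx, Set.mem_compl_iff, not_false_eq_true, Set.indicator_of_notMem,
        Set.indicator_of_mem, h2]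
      nlinarith [sq_nonneg (Real.exp (l x / 2) - 4)]
  have hi1 : Integrable (s.indicator fun x => Real.exp (l x)) μ := hei.indicator hs
  have hi2 : Integrable (sᶜ.indicator fun _ => (1 : ℝ)) μ := (integrable_const _).indicator hs.compl
  have hi3 : Integrable (fun x => 1 / 8 + Real.exp (l x) / 8) μ :=
    (integrable_const _).add (hei.div_const _)
  have hi4 : Integrable (fun x => 2 * (s.indicator (fun x => Real.exp (l x)) x +
      sᶜ.indicator (fun _ => (1 : ℝ)) x)) μ := (hi1.add hi2).const_mul _
  have := integral_mono ((integrable_const (1 : ℝ)).add (hli.div_const 2)) (hi3.add hi4) key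
  simp only [Pi.add_apply] at this
  rw [integral_add (integrable_const _) (hli.div_const 2), integral_add hi3 hi4,
    integral_add (integrable_const _) (hei.div_const _), integral_const_mul, integral_add hi1 hi2,
    integral_indicator hs, integral_indicator hs.compl, hreal s hs] at this
  simp only [integral_div, htot, integral_const, probReal_univ, smul_eq_mul, mul_one,
    measureReal_restrict_apply_univ] at this
  linarith

/-! ### Gaussian shifts and their divergence. -/

section Gaussian

lemma lintegral_gaussianReal_shift (a b : ℝ) {v : ℝ≥0} (hv : v ≠ 0) {u : ℝ → ℝ≥0∞}
    (hu : Measurable u) :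
    ∫⁻ y, u y ∂(gaussianReal b v) =
      ∫⁻ y, u y * ENNReal.ofReal (Real.exp ((b - a) * (2 * y - a - b) / (2 * v)))
        ∂(gaussianReal a v) := by
  rw [gaussianReal_of_var_ne_zero _ hv, gaussianReal_of_var_ne_zero _ hv,
    lintegral_withDensity_eq_lintegral_mul _ (measurable_gaussianPDF _ _) hu,
    lintegral_withDensity_eq_lintegral_mul _ (measurable_gaussianPDF _ _) (by fun_prop)]
  refine lintegral_congr fun y => ?_
  have h : gaussianPDF b v y = gaussianPDF a v y *
      ENNReal.ofReal (Real.exp ((b - a) * (2 * y - a - b) / (2 * v))) := by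
    have hv' : (v : ℝ) ≠ 0 := by exact_mod_cast hv
    rw [gaussianPDF, gaussianPDF, ← ENNReal.ofReal_mul (gaussianPDFReal_nonneg _ _ _),
      gaussianPDFReal, gaussianPDFReal, mul_assoc (√_)⁻¹, ← Real.exp_add]
    congr 3
    field_simp
    ring
  simp only [Pi.mul_apply, h]
  ring

lemma map_add_noise (σ : ℝ≥0) (a : ℝ × ℝ) : (noise σ).map (fun w => a + w) =
    (gaussianReal a.1 (σ ^ 2)).prod (gaussianReal a.2 (σ ^ 2)) := by
  have h : (fun w : ℝ × ℝ => a + w) = Prod.map (a.1 + ·) (a.2 + ·) := rfl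
  rw [h, noise, ← Measure.map_prod_map _ _ (by fun_prop) (by fun_prop),
    gaussianReal_map_const_add, gaussianReal_map_const_add, zero_add, zero_add]

/-- The logarithm of the density ratio of two Gaussian measures on the plane with covariance
`v • 1` and means `b` and `a`. -/
noncomputable def logRatio (v : ℝ) (a b y : ℝ × ℝ) : ℝ :=
  (b.1 - a.1) * (2 * y.1 - a.1 - b.1) / (2 * v) + (b.2 - a.2) * (2 * y.2 - a.2 - b.2) / (2 * v)

lemma lintegral_noise_shift {σ : ℝ≥0} (hσ : σ ≠ 0) (a b : ℝ × ℝ) {u : ℝ × ℝ → ℝ≥0∞}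
    (hu : Measurable u) :
    ∫⁻ y, u y ∂((noise σ).map fun w => b + w) =
      ∫⁻ y, u y * ENNReal.ofReal (Real.exp (logRatio (σ ^ 2) a b y))
        ∂((noise σ).map fun w => a + w) := by
  have hv : σ ^ 2 ≠ 0 := pow_ne_zero _ hσ
  have hm : Measurable fun y => u y * ENNReal.ofReal (Real.exp (logRatio (σ ^ 2) a b y)) := by
    unfold logRatio; fun_prop
  rw [map_add_noise, map_add_noise, lintegral_prod _ hu.aemeasurable,
    lintegral_prod _ hm.aemeasurable, lintegral_gaussianReal_shift a.1 b.1 hv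
      hu.lintegral_prod_right']
  refine lintegral_congr fun y₁ => ?_
  have hu₁ : Measurable fun y₂ => u (y₁, y₂) := hu.comp measurable_prodMk_left
  rw [lintegral_gaussianReal_shift a.2 b.2 hv hu₁, ← lintegral_mul_const _ (by fun_prop)]
  refine lintegral_congr fun y₂ => ?_
  rw [logRatio]
  push_cast
  rw [Real.exp_add, ENNReal.ofReal_mul (Real.exp_nonneg _)]
  ring

lemma integrable_fst_noise (σ : ℝ≥0) : Integrable (fun w : ℝ × ℝ => w.1) (noise σ) :=
  ((memLp_id_gaussianReal' 1 ENNReal.one_ne_top).integrable le_rfl).comp_fst _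

lemma integrable_snd_noise (σ : ℝ≥0) : Integrable (fun w : ℝ × ℝ => w.2) (noise σ) :=
  ((memLp_id_gaussianReal' 1 ENNReal.one_ne_top).integrable le_rfl).comp_snd _

lemma integral_fst_noise (σ : ℝ≥0) : ∫ w, w.1 ∂(noise σ) = 0 := by
  rw [noise, integral_fun_fst (fun x => x), integral_id_gaussianReal, smul_zero]

lemma integral_snd_noise (σ : ℝ≥0) : ∫ w, w.2 ∂(noise σ) = 0 := by
  rw [noise, integral_fun_snd (fun x => x), integral_id_gaussianReal, smul_zero]

/-- In terms of the noise `w` the ratio is affine: the linear part is centred, so the constant is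
its mean, minus the Gaussian divergence. -/
lemma logRatio_add (v : ℝ) (a b w : ℝ × ℝ) : logRatio v a b (a + w) =
    ((b.1 - a.1) / v * w.1 + (b.2 - a.2) / v * w.2) +
      -(((b.1 - a.1) ^ 2 + (b.2 - a.2) ^ 2) / (2 * v)) := by
  rcases eq_or_ne v 0 with rfl | hv
  · simp [logRatio]
  · simp only [logRatio, Prod.fst_add, Prod.snd_add]
    field_simp
    ring

lemma measurable_logRatio (v : ℝ) (a b : ℝ × ℝ) : Measurable (logRatio v a b) := by
  unfold logRatio; fun_prop

lemma integrable_logRatio (σ : ℝ≥0) (v : ℝ) (a b : ℝ × ℝ) :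
    Integrable (logRatio v a b) ((noise σ).map fun w => a + w) := by
  rw [integrable_map_measure (measurable_logRatio v a b).aestronglyMeasurable (by fun_prop)]
  simp only [Function.comp_def, logRatio_add]
  exact (((integrable_fst_noise σ).const_mul _).add ((integrable_snd_noise σ).const_mul _)).add
    (integrable_const _)

lemma integral_logRatio (σ : ℝ≥0) (v : ℝ) (a b : ℝ × ℝ) :
    ∫ y, logRatio v a b y ∂((noise σ).map fun w => a + w) =
      -(((b.1 - a.1) ^ 2 + (b.2 - a.2) ^ 2) / (2 * v)) := by
  have h₁ := (integrable_fst_noise σ).const_mul ((b.1 - a.1) / v)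
  have h₂ := (integrable_snd_noise σ).const_mul ((b.2 - a.2) / v)
  rw [integral_map (by fun_prop) (measurable_logRatio v a b).aestronglyMeasurable]
  simp only [logRatio_add]
  rw [integral_add (f := fun w => _ + _) (h₁.add h₂) (integrable_const _), integral_add h₁ h₂, integral_const_mul,
    integral_const_mul, integral_fst_noise, integral_snd_noise]
  simp

/-- The right-hand side depends on the means only through `D`, which supplies the query-independent
bound needed in `exists_logLikelihood`. -/
lemma integral_norm_logRatio_le (σ : ℝ≥0) {v D : ℝ} (hv : 0 < v) {a b : ℝ × ℝ}
    (h₁ : |b.1 - a.1| ≤ D) (h₂ : |b.2 - a.2| ≤ D) :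
    ∫ y, ‖logRatio v a b y‖ ∂((noise σ).map fun w => a + w) ≤
      ∫ w, (D / v * ‖w.1‖ + D / v * ‖w.2‖ + (D ^ 2 + D ^ 2) / (2 * v)) ∂(noise σ) := by
  rw [integral_map (by fun_prop) (measurable_logRatio v a b).norm.aestronglyMeasurable]
  refine integral_mono_of_nonneg (ae_of_all _ fun _ => norm_nonneg _)
    ((((integrable_fst_noise σ).norm.const_mul _).add
      ((integrable_snd_noise σ).norm.const_mul _)).add (integrable_const _))
    (ae_of_all _ fun w => ?_)
  simp only [logRatio_add]
  refine (norm_add_le _ _).trans (add_le_add ((norm_add_le _ _).trans (add_le_add ?_ ?_)) ?_)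
  · rw [norm_mul, norm_div, Real.norm_of_nonneg hv.le]
    gcongr
    exact h₁
  · rw [norm_mul, norm_div, Real.norm_of_nonneg hv.le]
    gcongr
    exact h₂
  · rw [norm_neg, Real.norm_of_nonneg (by positivity)]
    gcongr ?_ / _
    exact add_le_add (sq_le_sq' (abs_le.1 h₁).1 (abs_le.1 h₁).2)
      (sq_le_sq' (abs_le.1 h₂).1 (abs_le.1 h₂).2)

end Gaussian

/-! ### Elementary inequalities. -/

section Analysis

/-- A discrete form of integrating `x ^ (p - 1)`: Bernoulli's inequality for exponents at most `1`
bounds each summand by an increment of `x ^ p / p`. -/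
lemma sum_rpow_sub_one_le {p : ℝ} (hp : 0 < p) (hp' : p ≤ 1) (t : ℕ) :
    ∑ s ∈ Finset.range t, ((s : ℝ) + 1) ^ (p - 1) ≤ (t : ℝ) ^ p / p := by
  induction t with
  | zero => simp [Real.zero_rpow hp.ne']
  | succ t ih =>
    have ht : (0 : ℝ) < (t : ℝ) + 1 := by positivity
    have hb : (1 + -(1 / ((t : ℝ) + 1))) ^ p ≤ 1 + p * -(1 / ((t : ℝ) + 1)) := by
      refine rpow_one_add_le_one_add_mul_self ?_ hp.le hp'
      rw [neg_le_neg_iff, div_le_one ht]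
      linarith [(Nat.cast_nonneg t : (0 : ℝ) ≤ t)]
    have he : (t : ℝ) = (t + 1) * (1 + -(1 / ((t : ℝ) + 1))) := by field_simp; ring
    have h : (t : ℝ) ^ p ≤ ((t : ℝ) + 1) ^ p - p * ((t : ℝ) + 1) ^ (p - 1) := by
      have h0 : 0 ≤ 1 + -(1 / ((t : ℝ) + 1)) := by
        have : (1 + -(1 / ((t : ℝ) + 1))) = t / (t + 1) := by field_simp; ring
        rw [this]; positivity
      calc (t : ℝ) ^ p = ((t : ℝ) + 1) ^ p * (1 + -(1 / ((t : ℝ) + 1))) ^ p := by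
            rw [← Real.mul_rpow ht.le h0, ← he]
        _ ≤ ((t : ℝ) + 1) ^ p * (1 + p * -(1 / ((t : ℝ) + 1))) := by gcongr
        _ = _ := by rw [Real.rpow_sub_one ht.ne']; ring
    rw [Finset.sum_range_succ, Nat.cast_succ]
    refine (add_le_add_left ih _).trans ?_
    rw [← le_sub_iff_add_le]
    calc (t : ℝ) ^ p / p ≤ (((t : ℝ) + 1) ^ p - p * ((t : ℝ) + 1) ^ (p - 1)) / p := by gcongr
      _ = _ := by field_simp

lemma add_pow_le_two_pow_mul {a b : ℝ} (ha : 0 ≤ a) (hb : 0 ≤ b) (n : ℕ) :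
    (a + b) ^ n ≤ 2 ^ n * (a ^ n + b ^ n) := by
  rcases le_total a b with h | h
  · calc (a + b) ^ n ≤ (2 * b) ^ n := by gcongr; linarith
      _ ≤ 2 ^ n * (a ^ n + b ^ n) := by rw [mul_pow]; gcongr; linarith [pow_nonneg ha n]
  · calc (a + b) ^ n ≤ (2 * a) ^ n := by gcongr; linarith
      _ ≤ 2 ^ n * (a ^ n + b ^ n) := by rw [mul_pow]; gcongr; linarith [pow_nonneg hb n]

lemma abs_sub_pow_sub_pow_le {x δ : ℝ} (hδ : 0 ≤ δ) (n : ℕ) :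
    |(x - δ) ^ (n + 1) - x ^ (n + 1)| ≤ δ * (n + 1) * (|x| + δ) ^ n := by
  refine (abs_pow_sub_pow_le ..).trans ?_
  have h : |x - δ| ≤ |x| + δ := (abs_sub _ _).trans (by rw [abs_of_nonneg hδ])
  have h' : |x - δ - x| = δ := by rw [sub_sub_cancel_left, abs_neg, abs_of_nonneg hδ]
  rw [h', Nat.add_sub_cancel]
  push_cast
  gcongr
  exact max_le h (by linarith)

/-- The squared distance of the first-order information about `y ↦ (y - δ) ^ (n + 2)` and
`y ↦ y ^ (n + 2)` at the point `x`. -/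
lemma sq_add_sq_firstOrder_le {x δ : ℝ} (hx : |x| ≤ 1) (hδ : 0 ≤ δ) (hδ' : δ ≤ 1) (n : ℕ) :
    ((x - δ) ^ (n + 2) - x ^ (n + 2)) ^ 2 +
        ((n + 2) * (x - δ) ^ (n + 1) - (n + 2) * x ^ (n + 1)) ^ 2 ≤
      ((n + 2) ^ 2 * (4 + (n + 1) ^ 2) * 4 ^ n) * (δ ^ 2 * ((x ^ 2) ^ n + (δ ^ 2) ^ n)) := by
  set a := |x| + δ with ha
  have ha0 : 0 ≤ a := by positivity
  -- The values differ by one more power of `a` than the derivatives; since `a ≤ 2`, that factor is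
  -- absorbed in the constant.
  have h₁ : |(x - δ) ^ (n + 2) - x ^ (n + 2)| ≤ δ * (n + 2) * (2 * a ^ n) := by
    refine (abs_sub_pow_sub_pow_le hδ (n + 1)).trans ?_
    rw [pow_succ, ← ha, mul_comm (a ^ n)]
    push_cast
    have : a ≤ 2 := by linarith
    rw [add_assoc, one_add_one_eq_two]
    gcongr
  have h₂ : |(n + 2) * (x - δ) ^ (n + 1) - (n + 2) * x ^ (n + 1)| ≤
      (n + 2) * (δ * (n + 1) * a ^ n) := by
    rw [← mul_sub, abs_mul, abs_of_nonneg (by positivity : (0 : ℝ) ≤ n + 2)]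
    gcongr
    exact abs_sub_pow_sub_pow_le hδ n
  have h₃ : (a ^ n) ^ 2 ≤ 4 ^ n * ((x ^ 2) ^ n + (δ ^ 2) ^ n) := by
    calc (a ^ n) ^ 2 = a ^ (2 * n) := by rw [← pow_mul, mul_comm]
      _ ≤ 2 ^ (2 * n) * (|x| ^ (2 * n) + δ ^ (2 * n)) :=
        add_pow_le_two_pow_mul (abs_nonneg x) hδ _
      _ = _ := by rw [pow_mul, pow_mul, pow_mul, sq_abs]; norm_num
  calc _ ≤ (δ * (n + 2) * (2 * a ^ n)) ^ 2 + ((n + 2) * (δ * (n + 1) * a ^ n)) ^ 2 :=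
        add_le_add (sq_le_sq' (abs_le.1 h₁).1 (abs_le.1 h₁).2)
          (sq_le_sq' (abs_le.1 h₂).1 (abs_le.1 h₂).2)
    _ = (n + 2) ^ 2 * (4 + (n + 1) ^ 2) * δ ^ 2 * (a ^ n) ^ 2 := by ring
    _ ≤ (n + 2) ^ 2 * (4 + (n + 1) ^ 2) * δ ^ 2 * (4 ^ n * ((x ^ 2) ^ n + (δ ^ 2) ^ n)) := by
        gcongr
    _ = _ := by ring

/-- A substitute for Jensen's inequality: splitting at `y = q` bounds a lower moment by a higher
one, with `q` free to balance the two terms. -/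
lemma pow_le_pow_add_pow_div {y q : ℝ} (hy : 0 ≤ y) (hq : 0 < q) (n : ℕ) :
    y ^ n ≤ q ^ n + y ^ (n + 2) / q ^ 2 := by
  rcases le_total y q with h | h
  · have : y ^ n ≤ q ^ n := by gcongr
    have : 0 ≤ y ^ (n + 2) / q ^ 2 := by positivity
    linarith
  · have : y ^ n ≤ y ^ (n + 2) / q ^ 2 := by
      rw [le_div_iff₀ (by positivity), pow_add]
      gcongr
    have : 0 ≤ q ^ n := by positivity
    linarith

/-- An eventually bounded real sequence is bounded; the shift to `t + 1` makes the rate meaningful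
at `t = 0`. -/
lemma exists_forall_le_rpow_neg {w : ℕ → ℝ} (hw : ∀ t, 0 ≤ w t) {γ C : ℝ} (hγ : 0 ≤ γ)
    (h : ∀ᶠ t : ℕ in atTop, (t : ℝ) ^ γ * w t ≤ C) :
    ∃ C', 0 ≤ C' ∧ ∀ t : ℕ, w t ≤ C' * ((t : ℝ) + 1) ^ (-γ) := by
  have hb : BddAbove (Set.range fun t : ℕ => ((t : ℝ) + 1) ^ γ * w t) := by
    refine IsBoundedUnder.bddAbove_range ⟨2 ^ γ * C, ?_⟩
    rw [eventually_map]
    filter_upwards [h, eventually_ge_atTop 1] with t ht h1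
    have h1' : (1 : ℝ) ≤ t := by exact_mod_cast h1
    calc ((t : ℝ) + 1) ^ γ * w t ≤ (2 * t) ^ γ * w t := by
          have := hw t
          gcongr
          linarith
      _ = 2 ^ γ * (t ^ γ * w t) := by
          rw [Real.mul_rpow (by norm_num) (by positivity), mul_assoc]
      _ ≤ 2 ^ γ * C := by gcongr
  obtain ⟨C', hC'⟩ := hb
  refine ⟨C', le_trans (mul_nonneg (by positivity) (hw 0)) (hC' ⟨0, rfl⟩), fun t => ?_⟩
  have := hC' ⟨t, rfl⟩
  rw [Real.rpow_neg (by positivity), ← div_eq_mul_inv, le_div_iff₀ (by positivity), mul_comm]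
  exact this

end Analysis

/-! ### Likelihoods and moments for the power functions. -/

section PowClass

variable {m : ℕ} {hm : 0 < m} {hm' : Even m} {σ : ℝ≥0}

/-- The function `x ↦ (x - θ) ^ m` as an instance of `powClass`. -/
noncomputable def powInst (hm : 0 < m) (hm' : Even m) (σ : ℝ≥0) (θ : Interval) :
    (powClass hm hm' σ).instances := ⟨powFun m θ, θ, rfl⟩

lemma oracle_powInst (θ : Interval) (x : (powClass hm hm' σ).domain) :
    (powClass hm hm' σ).oracle (powInst hm hm' σ θ, x) =
      (noise σ).map fun w => ((((x : ℝ) - θ) ^ m, m * ((x : ℝ) - θ) ^ (m - 1)) : ℝ × ℝ) + w := by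
  rw [← firstOrder_powFun m θ x]
  rfl

lemma err_powInst (θ : Interval) (x : (powClass hm hm' σ).domain) :
    (powClass hm hm' σ).err (powInst hm hm' σ θ) x = ((x : ℝ) - θ) ^ m := by
  have h : ⨅ z : Interval, powFun m θ z = 0 := by
    have : Nonempty Interval := ⟨θ⟩
    have h0 : ∀ z : Interval, 0 ≤ powFun m θ z := fun z => hm'.pow_nonneg _
    refine le_antisymm ((ciInf_le ⟨0, ?_⟩ θ).trans_eq ?_) (le_ciInf h0)
    · rintro _ ⟨z, rfl⟩; exact h0 z
    · change ((θ : ℝ) - θ) ^ m = 0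
      rw [sub_self, zero_pow hm.ne']
  change ((x : ℝ) - θ) ^ m - ⨅ z : Interval, powFun m θ z = _
  rw [h, sub_zero]

variable (A : (powClass hm hm' σ).Algorithm)

lemma measurable_coe_next (t : ℕ) :
    Measurable fun h => ((A.next t h : (powClass hm hm' σ).domain) : ℝ) :=
  measurable_subtype_coe.comp (A.measurable_next t)

lemma abs_next_le (t : ℕ) (h : (powClass hm hm' σ).History t) : |(A.next t h : ℝ)| ≤ 1 :=
  abs_le.2 (A.next t h).2

lemma integrable_comp_next {t : ℕ} {F : ℝ → ℝ} (hF : Continuous F)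
    (μ : Measure ((powClass hm hm' σ).History t)) [IsFiniteMeasure μ] :
    Integrable (fun h => F (A.next t h)) μ := by
  obtain ⟨C, hC⟩ := (isCompact_Icc (a := (-1 : ℝ)) (b := 1)).exists_bound_of_continuousOn
    hF.continuousOn
  exact Integrable.of_bound (hF.measurable.comp (measurable_coe_next A t)).aestronglyMeasurable C
    (ae_of_all _ fun h => hC _ (A.next t h).2)

lemma ofReal_integral_le_worstErr (θ : Interval) (t : ℕ) :
    ENNReal.ofReal (∫ h, ((A.next t h : ℝ) - θ) ^ (2 * m) ∂(A.law (powInst hm hm' σ θ) t)) ≤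
      A.worstErr 2 t := by
  refine le_trans (le_of_eq ?_) (le_iSup (fun f => A.expectedErr 2 t f) (powInst hm hm' σ θ))
  rw [ofReal_integral_eq_lintegral_ofReal
    (integrable_comp_next A (F := fun x => (x - θ) ^ (2 * m)) (by fun_prop) _)
    (ae_of_all _ fun h => (even_two_mul m).pow_nonneg _)]
  refine lintegral_congr fun h => ?_
  rw [err_powInst, Real.rpow_two, ← pow_mul, mul_comm]

lemma worstErr_ne_top (t : ℕ) : A.worstErr 2 t ≠ ∞ := by
  refine ne_top_of_le_ne_top (b := ENNReal.ofReal (2 ^ (m * 2))) ENNReal.ofReal_ne_top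
    (iSup_le fun f => ?_)
  obtain ⟨_, θ, rfl⟩ := f
  refine (lintegral_mono (g := fun _ => ENNReal.ofReal (2 ^ (m * 2))) fun h => ?_).trans ?_
  · have he := err_powInst (hm := hm) (hm' := hm') (σ := σ) θ (A.next t h)
    rw [powInst] at he
    rw [he, Real.rpow_two, ← pow_mul]
    refine ENNReal.ofReal_le_ofReal ((le_abs_self _).trans ?_)
    rw [abs_pow]
    gcongr
    have h₁ := abs_next_le A t h
    have h₂ : |(θ : ℝ)| ≤ 1 := abs_le.2 θ.2
    linarith [abs_sub (A.next t h : ℝ) θ]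
  · simp

lemma logLikelihood_powInst (hσ : σ ≠ 0) (θ δ : Interval) (t : ℕ) :
    ∃ l : (powClass hm hm' σ).History t → ℝ, Measurable l ∧
      Integrable l (A.law (powInst hm hm' σ θ) t) ∧
      (∀ u : (powClass hm hm' σ).History t → ℝ≥0∞, Measurable u →
        ∫⁻ h, u h ∂(A.law (powInst hm hm' σ δ) t) =
        ∫⁻ h, u h * ENNReal.ofReal (Real.exp (l h))
          ∂(A.law (powInst hm hm' σ θ) t)) ∧
      ∫ h, l h ∂(A.law (powInst hm hm' σ θ) t) =
        -∑ s ∈ Finset.range t, ∫ h, (((((A.next s h : ℝ) - δ) ^ m - ((A.next s h : ℝ) - θ) ^ m) ^ 2 +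
          (m * ((A.next s h : ℝ) - δ) ^ (m - 1) - m * ((A.next s h : ℝ) - θ) ^ (m - 1)) ^ 2) /
            (2 * (σ : ℝ) ^ 2)) ∂(A.law (powInst hm hm' σ θ) s) := by
  have hv : (0 : ℝ) < (σ : ℝ) ^ 2 := by
    have : (0 : ℝ) < σ := lt_of_le_of_ne σ.2 (by exact_mod_cast hσ.symm)
    positivity
  let a : Interval → (powClass hm hm' σ).domain → ℝ × ℝ :=
    fun z x => (((x : ℝ) - z) ^ m, m * ((x : ℝ) - z) ^ (m - 1))
  have hdiff : ∀ k : ℕ, ∀ x z : Interval, |((x : ℝ) - z) ^ k| ≤ 2 ^ k := fun k x z => by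
    rw [abs_pow]
    gcongr
    have h₁ : |(x : ℝ)| ≤ 1 := abs_le.2 x.2
    have h₂ : |(z : ℝ)| ≤ 1 := abs_le.2 z.2
    linarith [abs_sub (x : ℝ) z]
  have hmeas : Measurable (Function.uncurry fun x y =>
      logRatio ((σ : ℝ) ^ 2) (a θ x) (a δ x) y) := by
    have hx : Measurable fun p : (powClass hm hm' σ).domain × (ℝ × ℝ) => (p.1 : ℝ) :=
      measurable_subtype_coe.comp measurable_fst
    simp only [Function.uncurry_def, logRatio, a]
    fun_prop
  obtain ⟨l, h₁, h₂, h₃, h₄⟩ := A.exists_logLikelihood (powInst hm hm' σ θ)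
    (powInst hm hm' σ δ) hmeas
    (k := fun x => (((a δ x).1 - (a θ x).1) ^ 2 +
      ((a δ x).2 - (a θ x).2) ^ 2) / (2 * (σ : ℝ) ^ 2))
    -- Points of the interval are at distance at most `2`, so `2 * m * 2 ^ m` dominates the
    -- differences of both values and derivatives.
    (M := ∫ w, ((2 * m * 2 ^ m) / (σ : ℝ) ^ 2 * ‖w.1‖ + (2 * m * 2 ^ m) / (σ : ℝ) ^ 2 * ‖w.2‖ +
      ((2 * m * 2 ^ m) ^ 2 + (2 * m * 2 ^ m) ^ 2) / (2 * (σ : ℝ) ^ 2)) ∂(noise σ))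
    (fun x u hu => by
      rw [oracle_powInst, oracle_powInst]; exact lintegral_noise_shift hσ _ _ hu)
    (fun x => by rw [oracle_powInst]; exact integrable_logRatio σ _ _ _)
    (fun x => by rw [oracle_powInst]; exact integral_logRatio σ _ _ _)
    (fun x => by
      rw [oracle_powInst]
      have hm1 : (1 : ℝ) ≤ m := by exact_mod_cast hm
      refine integral_norm_logRatio_le σ hv ((abs_sub _ _).trans ?_) ((abs_sub _ _).trans ?_)
      · have e₁ := hdiff m x δ
        have e₂ := hdiff m x θ
        have : (2 : ℝ) ^ m ≤ m * 2 ^ m := le_mul_of_one_le_left (by positivity) hm1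
        simp only [a] at *
        linarith
      · have e₁ := hdiff (m - 1) x δ
        have e₂ := hdiff (m - 1) x θ
        have e₃ : (2 : ℝ) ^ (m - 1) ≤ 2 ^ m := pow_le_pow_right₀ (by norm_num) (Nat.sub_le _ _)
        simp only [a, abs_mul, Nat.abs_cast] at *
        have e₄ := mul_le_mul_of_nonneg_left (e₁.trans e₃) (by positivity : (0 : ℝ) ≤ m)
        have e₅ := mul_le_mul_of_nonneg_left (e₂.trans e₃) (by positivity : (0 : ℝ) ≤ m)
        linarith) t
  exact ⟨l, h₁, h₂, h₃, h₄⟩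

/-- Markov's inequality for the distance of the candidate minimizer to `θ`. -/
lemma real_law_le {t : ℕ} {θ : Interval} {ε η : ℝ} (hη : 0 < η)
    (hε : ∫ h, ((A.next t h : ℝ) - θ) ^ (2 * m) ∂(A.law (powInst hm hm' σ θ) t) ≤ ε)
    {s : Set ((powClass hm hm' σ).History t)} (hs : ∀ h ∈ s, η ≤ |(A.next t h : ℝ) - θ|) :
    (A.law (powInst hm hm' σ θ) t).real s ≤ ε / η ^ (2 * m) := by
  rw [le_div_iff₀ (by positivity), mul_comm]
  refine le_trans ?_ hε
  refine le_trans ?_ (mul_meas_ge_le_integral_of_nonneg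
    (ae_of_all _ fun h => (even_two_mul m).pow_nonneg _)
    (integrable_comp_next A (F := fun x => (x - θ) ^ (2 * m)) (by fun_prop) _) (η ^ (2 * m)))
  refine mul_le_mul_of_nonneg_left (measureReal_mono fun h hh => ?_) (by positivity)
  change η ^ (2 * m) ≤ ((A.next t h : ℝ) - θ) ^ (2 * m)
  rw [← (even_two_mul m).pow_abs ((A.next t h : ℝ) - θ)]
  gcongr
  exact hs h hh

end PowClass

/-! ### Information bound and contradiction. -/

section LowerBound

variable {n : ℕ} {hm : 0 < n + 2} {hm' : Even (n + 2)} {σ : ℝ≥0}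
  (A : (powClass hm hm' σ).Algorithm)

/-- Under the decay hypothesis, the information that the first `t` answers carry about `δ` is at
most the right-hand side. -/
lemma sum_divergence_le {zero δ : Interval} (h0 : (zero : ℝ) = 0) (hδ : 0 ≤ (δ : ℝ)) {C : ℝ}
    (hC : 0 ≤ C)
    (hA : ∀ s : ℕ, ∫ h, ((A.next s h : ℝ) - zero) ^ (2 * (n + 2))
      ∂(A.law (powInst hm hm' σ zero) s) ≤ C * ((s : ℝ) + 1) ^ (-((n + 2 : ℝ) / (n + 1)))) (t : ℕ) :
    ∑ s ∈ Finset.range t, ∫ h, (((((A.next s h : ℝ) - δ) ^ (n + 2) -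
        ((A.next s h : ℝ) - zero) ^ (n + 2)) ^ 2 +
        (((n + 2 : ℕ) : ℝ) * ((A.next s h : ℝ) - δ) ^ (n + 2 - 1) -
          ((n + 2 : ℕ) : ℝ) * ((A.next s h : ℝ) - zero) ^ (n + 2 - 1)) ^ 2) / (2 * (σ : ℝ) ^ 2))
            ∂(A.law (powInst hm hm' σ zero) s) ≤
      ((n + 2) ^ 2 * (4 + (n + 1) ^ 2) * 4 ^ n) / (2 * (σ : ℝ) ^ 2) *
        ((1 + C) * (n + 1) * ((δ : ℝ) ^ 2 * (t : ℝ) ^ (1 / (n + 1 : ℝ))) +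
          t * (δ : ℝ) ^ (2 * n + 2)) := by
  set K : ℝ := ((n + 2) ^ 2 * (4 + (n + 1) ^ 2) * 4 ^ n) with hK
  have hK0 : 0 ≤ K := by positivity
  set p : ℝ := 1 / (n + 1 : ℝ) with hp
  have hp0 : 0 < p := by positivity
  have hp1 : p ≤ 1 := by
    rw [hp, div_le_one (by positivity)]
    linarith [(Nat.cast_nonneg n : (0 : ℝ) ≤ n)]
  have hstep : ∀ s : ℕ, ∫ h, (((((A.next s h : ℝ) - δ) ^ (n + 2) -
        ((A.next s h : ℝ) - zero) ^ (n + 2)) ^ 2 +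
        (((n + 2 : ℕ) : ℝ) * ((A.next s h : ℝ) - δ) ^ (n + 2 - 1) -
          ((n + 2 : ℕ) : ℝ) * ((A.next s h : ℝ) - zero) ^ (n + 2 - 1)) ^ 2) / (2 * (σ : ℝ) ^ 2))
            ∂(A.law (powInst hm hm' σ zero) s) ≤
      K / (2 * (σ : ℝ) ^ 2) * (δ : ℝ) ^ 2 * ((1 + C) * ((s : ℝ) + 1) ^ (p - 1) +
        ((δ : ℝ) ^ 2) ^ n) := by
    intro s
    have hs : (0 : ℝ) < (s : ℝ) + 1 := by positivity
    -- The typical size of the squared query: `q ^ (n + 2)` is exactly the assumed moment rate, so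
    -- both terms of `pow_le_pow_add_pow_div` become of order `q ^ n`.
    set q : ℝ := ((s : ℝ) + 1) ^ (-p) with hq
    have hq0 : 0 < q := by positivity
    have hqn : q ^ n = ((s : ℝ) + 1) ^ (p - 1) := by
      rw [hq, ← Real.rpow_mul_natCast hs.le]
      congr 1
      rw [hp]; field_simp; ring
    have hqn2 : q ^ (n + 2) = ((s : ℝ) + 1) ^ (-((n + 2 : ℝ) / (n + 1))) := by
      rw [hq, ← Real.rpow_mul_natCast hs.le]
      congr 1
      rw [hp]; push_cast; field_simp
    have hmom := hA s
    rw [← hqn2] at hmom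
    have hc : Continuous fun x : ℝ => (((x - δ) ^ (n + 2) - (x - zero) ^ (n + 2)) ^ 2 +
        (((n + 2 : ℕ) : ℝ) * (x - δ) ^ (n + 2 - 1) -
          ((n + 2 : ℕ) : ℝ) * (x - zero) ^ (n + 2 - 1)) ^ 2) / (2 * (σ : ℝ) ^ 2) := by fun_prop
    have hc' : Continuous fun x : ℝ => (x - zero) ^ (2 * (n + 2)) := by fun_prop
    have hi := integrable_comp_next A hc' (A.law (powInst hm hm' σ zero) s)
    calc _ ≤ ∫ h, (K / (2 * (σ : ℝ) ^ 2) * (δ : ℝ) ^ 2 *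
          (q ^ n + ((A.next s h : ℝ) - zero) ^ (2 * (n + 2)) / q ^ 2 + ((δ : ℝ) ^ 2) ^ n))
            ∂(A.law (powInst hm hm' σ zero) s) := by
          refine integral_mono (integrable_comp_next A hc _)
            (((((integrable_const _).add (hi.div_const _)).add (integrable_const _))).const_mul _)
            fun h => ?_
          have e₁ := sq_add_sq_firstOrder_le (abs_next_le A s h) hδ δ.2.2 n
          have e₂ := pow_le_pow_add_pow_div (sq_nonneg (A.next s h : ℝ)) hq0 n
          simp only [h0, sub_zero, pow_mul]
          calc _ ≤ K * ((δ : ℝ) ^ 2 * (((A.next s h : ℝ) ^ 2) ^ n + ((δ : ℝ) ^ 2) ^ n)) /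
                (2 * (σ : ℝ) ^ 2) := by
                gcongr
                push_cast
                exact e₁
            _ = K / (2 * (σ : ℝ) ^ 2) * (δ : ℝ) ^ 2 *
                (((A.next s h : ℝ) ^ 2) ^ n + ((δ : ℝ) ^ 2) ^ n) := by ring
            _ ≤ _ := by gcongr
      _ = K / (2 * (σ : ℝ) ^ 2) * (δ : ℝ) ^ 2 * (q ^ n +
          (∫ h, ((A.next s h : ℝ) - zero) ^ (2 * (n + 2)) ∂(A.law (powInst hm hm' σ zero) s)) /
            q ^ 2 + ((δ : ℝ) ^ 2) ^ n) := by
          rw [integral_const_mul, integral_add (f := fun h => _ + _)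
            ((integrable_const _).add (hi.div_const _)) (integrable_const _),
            integral_add (integrable_const _) (hi.div_const _), integral_div]
          simp
      _ ≤ K / (2 * (σ : ℝ) ^ 2) * (δ : ℝ) ^ 2 * (q ^ n + C * q ^ (n + 2) / q ^ 2 +
          ((δ : ℝ) ^ 2) ^ n) := by gcongr
      _ = _ := by rw [← hqn, pow_add q n 2]; field_simp
  refine (Finset.sum_le_sum fun s _ => hstep s).trans ?_
  rw [← Finset.mul_sum, Finset.sum_add_distrib, ← Finset.mul_sum, Finset.sum_const,
    Finset.card_range, nsmul_eq_mul]
  calc _ ≤ K / (2 * (σ : ℝ) ^ 2) * (δ : ℝ) ^ 2 * ((1 + C) * ((t : ℝ) ^ p / p) +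
        t * ((δ : ℝ) ^ 2) ^ n) := by
        gcongr
        exact sum_rpow_sub_one_le hp0 hp1 t
    _ = _ := by rw [← pow_mul, hp]; field_simp; ring

lemma tendsto_const_mul_rpow_neg (c : ℝ) {e : ℝ} (he : 0 < e) :
    Tendsto (fun t : ℕ => c * (t : ℝ) ^ (-e)) atTop (nhds 0) := by
  simpa using ((tendsto_rpow_neg_atTop he).comp tendsto_natCast_atTop_atTop).const_mul c

/-- No algorithm drives the second moment of the error to zero at the rate `t ^ (-γ)`. -/
lemma not_forall_integral_le (hσ : σ ≠ 0) {γ C : ℝ} (hγ : (n + 2 : ℝ) / (n + 1) < γ) (hC : 0 ≤ C) :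
    ¬ ∀ (θ : Interval) (s : ℕ), ∫ h, ((A.next s h : ℝ) - θ) ^ (2 * (n + 2))
      ∂(A.law (powInst hm hm' σ θ) s) ≤ C * ((s : ℝ) + 1) ^ (-γ) := by
  intro hA
  set K : ℝ := ((n + 2) ^ 2 * (4 + (n + 1) ^ 2) * 4 ^ n) / (2 * (σ : ℝ) ^ 2) with hK
  set p : ℝ := 1 / (n + 1 : ℝ) with hp
  have hγ0 : 0 < γ := lt_trans (by positivity) hγ
  -- Chosen so that Markov's inequality at distance `d / 2` leaves probability at most `1 / 16`; the
  -- `+ 1` gives `B ≤ B ^ (2 * (n + 2))`.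
  set B : ℝ := 16 * C * 4 ^ (n + 2) + 1 with hB
  have hB1 : 1 ≤ B := by rw [hB]; linarith [show 0 ≤ 16 * C * 4 ^ (n + 2) by positivity]
  have hB0 : 0 < B := by linarith
  -- Makes `d ^ (2 * (n + 2))` decay like `t ^ (-γ)`, the rate of the moment.
  set e : ℝ := γ / (2 * (n + 2)) with he
  have he0 : 0 < e := by positivity
  have hγ' : (n + 2 : ℝ) < γ * (n + 1) := (div_lt_iff₀ (by positivity)).1 hγ
  have hlim₁ : Tendsto (fun t : ℕ => (B * (t : ℝ) ^ (-e)) ^ 2 * (t : ℝ) ^ p) atTop (nhds 0) := by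
    have h1 : 0 < 2 * e - p := by
      rw [he, hp, sub_pos, div_lt_iff₀ (by positivity)]
      field_simp
      linarith
    refine (tendsto_const_mul_rpow_neg (B ^ 2) h1).congr' ?_
    filter_upwards [eventually_gt_atTop 0] with t ht
    have ht' : (0 : ℝ) < t := by exact_mod_cast ht
    rw [mul_pow, mul_assoc, ← Real.rpow_mul_natCast ht'.le, ← Real.rpow_add ht']
    congr 2
    push_cast
    ring
  have hlim₂ : Tendsto (fun t : ℕ => t * (B * (t : ℝ) ^ (-e)) ^ (2 * n + 2)) atTop (nhds 0) := by
    have h1 : 0 < (2 * n + 2) * e - 1 := by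
      rw [he, sub_pos]
      field_simp
      linarith
    refine (tendsto_const_mul_rpow_neg (B ^ (2 * n + 2)) h1).congr' ?_
    filter_upwards [eventually_gt_atTop 0] with t ht
    have ht' : (0 : ℝ) < t := by exact_mod_cast ht
    rw [mul_pow, ← Real.rpow_mul_natCast ht'.le, mul_left_comm]
    congr 1
    rw [← Real.rpow_one_add' ht'.le]
    · congr 1
      push_cast
      ring
    · push_cast
      linarith
  have hlim : Tendsto (fun t : ℕ => K * ((1 + C) * (n + 1) * ((B * (t : ℝ) ^ (-e)) ^ 2 *
      (t : ℝ) ^ p) + t * (B * (t : ℝ) ^ (-e)) ^ (2 * n + 2))) atTop (nhds 0) := by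
    simpa using ((hlim₁.const_mul ((1 + C) * (n + 1))).add hlim₂).const_mul K
  obtain ⟨t, ht, hδ1, hinf⟩ := ((eventually_gt_atTop 0).and
    (((tendsto_const_mul_rpow_neg B he0).eventually_le_const one_pos).and
      (hlim.eventually_lt_const one_pos))).exists
  have ht' : (0 : ℝ) < t := by exact_mod_cast ht
  set d : ℝ := B * (t : ℝ) ^ (-e) with hd
  have hd0 : 0 < d := by positivity
  let zero : Interval := ⟨0, by norm_num⟩
  let δ : Interval := ⟨d, by linarith, hδ1⟩
  obtain ⟨l, hlm, hli, hld, hlk⟩ := logLikelihood_powInst A hσ zero δ t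
  -- The information bound needs only the critical rate, which the assumed faster decay implies.
  have hsum := sum_divergence_le A (zero := zero) (δ := δ) rfl hd0.le hC (fun s => by
    refine (hA zero s).trans ?_
    gcongr
    linarith [(Nat.cast_nonneg s : (0 : ℝ) ≤ s)]) t
  set S : Set ((powClass hm hm' σ).History t) := {h | (A.next t h : ℝ) ≤ d / 2} with hS
  have hSm : MeasurableSet S := measurableSet_le (measurable_coe_next A t) measurable_const
  have htest := le_testing_error hlm hli hld hSm
  have hbound : C * ((t : ℝ) + 1) ^ (-γ) / (d / 2) ^ (2 * (n + 2)) ≤ 1 / 16 := by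
    have hdpow : d ^ (2 * (n + 2)) = B ^ (2 * (n + 2)) * (t : ℝ) ^ (-γ) := by
      rw [hd, mul_pow, ← Real.rpow_mul_natCast ht'.le]
      congr 2
      rw [he]; push_cast; field_simp
    have hle : ((t : ℝ) + 1) ^ (-γ) ≤ (t : ℝ) ^ (-γ) :=
      Real.rpow_le_rpow_of_nonpos ht' (by linarith) (by linarith)
    have hBB : 16 * C * 4 ^ (n + 2) ≤ B ^ (2 * (n + 2)) :=
      le_trans (by rw [hB]; linarith) (le_self_pow₀ hB1 (by omega))
    have h4 : (2 : ℝ) ^ (2 * (n + 2)) = 4 ^ (n + 2) := by rw [pow_mul]; norm_num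
    rw [div_le_iff₀ (by positivity), div_pow, hdpow, h4]
    calc C * ((t : ℝ) + 1) ^ (-γ) ≤ C * (t : ℝ) ^ (-γ) := by gcongr
      _ = 1 / 16 * ((16 * C * 4 ^ (n + 2)) * (t : ℝ) ^ (-γ) / 4 ^ (n + 2)) := by field_simp
      _ ≤ _ := by gcongr
  have hS₁ : (A.law (powInst hm hm' σ δ) t).real S ≤ 1 / 16 :=
    (real_law_le A (by positivity : 0 < d / 2) (hA δ t) fun h hh => by
      have : (A.next t h : ℝ) ≤ d / 2 := hh
      change d / 2 ≤ |(A.next t h : ℝ) - d|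
      rw [abs_sub_comm]
      exact le_trans (by linarith) (le_abs_self _)).trans hbound
  have hS₂ : (A.law (powInst hm hm' σ zero) t).real Sᶜ ≤ 1 / 16 :=
    (real_law_le A (by positivity : 0 < d / 2) (hA zero t) fun h hh => by
      have : d / 2 < (A.next t h : ℝ) := not_le.1 hh
      change d / 2 ≤ |(A.next t h : ℝ) - 0|
      rw [sub_zero]
      exact this.le.trans (le_abs_self _)).trans hbound
  -- Divergence below `1` forces the left side of `htest` above `3/4 - 1/2 = 1/4`, while two errors
  -- of at most `1/16` keep the right side at most `1/4`.
  have hsum' := hsum.trans_lt hinf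
  linarith

end LowerBound

end StochOpt

/-! ### Conclusion for the exponent. -/

theorem theorem7 (m : ℕ) (hm : 0 < m) (hm' : Even m) (σ : ℝ≥0) (hσ : 0 < σ) :
    (StochOpt.powClass hm hm' σ).anytimeExponent 2 ≤ ENNReal.ofReal ((m : ℝ) / ((m : ℝ) - 1)) := by
  refine iSup₂_le fun γ ⟨A, hA⟩ => ?_
  obtain ⟨n, rfl⟩ : ∃ n, m = n + 2 := by
    obtain ⟨k, rfl⟩ := hm'
    exact ⟨k + k - 2, by omega⟩
  have hcast : ((n + 2 : ℕ) : ℝ) / (((n + 2 : ℕ) : ℝ) - 1) = (n + 2 : ℝ) / (n + 1) := by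
    push_cast; congr 1; ring
  rw [hcast]
  by_contra! hγ
  rw [← ENNReal.ofReal_coe_nnreal, ENNReal.ofReal_lt_ofReal_iff_of_nonneg (by positivity)] at hγ
  -- A finite constant strictly above the limsup bounds the sequence eventually.
  obtain ⟨C, hC, hC'⟩ := exists_between hA
  obtain ⟨C', hC'0, hle⟩ := StochOpt.exists_forall_le_rpow_neg
    (w := fun t => (A.worstErr 2 t).toReal) (fun _ => ENNReal.toReal_nonneg) γ.2 (C := C.toReal) (by
      filter_upwards [eventually_lt_of_limsup_lt hC] with t ht
      have := ENNReal.toReal_mono hC'.ne ht.le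
      rwa [ENNReal.toReal_mul, ← ENNReal.toReal_rpow, ENNReal.toReal_natCast] at this)
  exact StochOpt.not_forall_integral_le A hσ.ne' hγ hC'0 fun θ s =>
    ((ENNReal.ofReal_le_iff_le_toReal (StochOpt.worstErr_ne_top A s)).1
      (StochOpt.ofReal_integral_le_worstErr A θ s)).trans (hle s)
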